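/- Let $\mathcal{C}$ be an abelian category, $I$ a nonempty finite set, and for each $i\in I$ let $\mathcal{C}_i$ be an abelian category, $G_i:\mathcal{C}\to\mathcal{C}_i$ a faithful exact functor, and $F_i:\mathcal{C}_i\to\mathcal{C}$ a left adjoint of $G_i$. Suppose that each $F_i$ is exact and resolving, i.e. every object of $\mathcal{C}_i$ admits an epimorphism from a projective object $P$ such that $F_iP$ is projective. Let $FG=\bigoplus_{i\in I}F_iG_i:\mathcal{C}\to\mathcal{C}$, and let $\epsilon_Y: FGY\to Y$ be the counit map of the adjunction between $F=\bigoplus_i F_i:\prod_i\mathcal{C}_i\to\mathcal{C}$ and $G=(G_i)_i$; it is an epimorphism. Let $E_0$ be the class of short exact sequences isomorphic to one of the form $0\to\ker\epsilon_Y\to FGY\to Y\to 0$ with $Y$ an object of $\mathcal{C}$, and let $E$ be the allowable class of relative homological algebra which it determines, namely the class of all short exact sequences in $\mathcal{C}$ that become split under every $G_i$. For a class $W$ of short exact sequences, an object $J$ is $W$-injective if for every $0\to A\to B\to Q\to 0$ in $W$ every morphism $A\to J$ extends to $B$; $\mathcal{C}$ has enough $W$-injectives if every object $A$ fits into a sequence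 $0\to A\to J\to Q\to 0$ in $W$ with $J$ a $W$-injective; and a contravariant functor $T$ from $\mathcal{C}$ to abelian groups is left $W$-exact if $0\to T(Q)\to T(B)\to T(A)$ is exact for every $0\to A\to B\to Q\to 0$ in $W$. For objects $X,Y$ of $\mathcal{C}$ put $U_0=V_1=Y$, $V_0=0$, $U_s=FGV_s$ and $V_{s+1}=\ker(\epsilon_{V_s}:U_s\to V_s)$ for $s\ge 1$. The compatible splitting spectral sequence of $(Y,X)$ is the spectral sequence $$E_1^{s,t}=\operatorname{Ext}^t_{\mathcal{C}}(U_s,X),\qquad d_r:E_r^{s,t}\to E_r^{s+r,t-r+1},$$ of the resolution $\cdots\to U_2\to U_1\to U_0\to 0$, i.e. that of the exact couple formed by the long exact sequences of $\operatorname{Ext}^*_{\mathcal{C}}(-,X)$ for the short exact sequences $0\to V_{s+1}\to U_s\to V_s\to 0$. Suppose that $\mathcal{C}$ has enough $E$-injectives. Let $X$ be an object of $\mathcal{C}$ and $t\ge 0$ an integer. Then the functor $\operatorname{Ext}^t_{\mathcal{C}}(-,X)$ is left $E$-exact if and only if, for all objects $Y$ of $\mathcal{C}$, the groups $E_2^{0,t}$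 and $E_2^{1,t}$ of the compatible splitting spectral sequence of $(Y,X)$ vanish. The same equivalence holds with left $E_0$-exactness in place of left $E$-exactness. -/

import Mathlib

open CategoryTheory Limits Abelian

universe w v u v₂ u₂ u₁

attribute [local instance 2000] CategoryTheory.CategoryStruct.toQuiver

noncomputable section

/-- A first quadrant exact couple of abelian groups
`D (s + 1, t) → D (s, t + 1) → E (s, t + 1) → D (s + 1, t + 1)`; the groups with a negative index
are zero, which is what the last two fields express. -/
structure ExactCouple where
  D : ℕ × ℕ → Type w
  E : ℕ × ℕ → Type w
  [grpD : ∀ p, AddCommGroup (D p)]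
  [grpE : ∀ p, AddCommGroup (E p)]
  i (s t : ℕ) : D (s + 1, t) →+ D (s, t + 1)
  j (s t : ℕ) : D (s, t) →+ E (s, t)
  k (s t : ℕ) : E (s, t) →+ D (s + 1, t)
  exact_jk (s t : ℕ) : Function.Exact (j s t) (k s t)
  exact_ki (s t : ℕ) : Function.Exact (k s t) (i s t)
  exact_ij (s t : ℕ) : Function.Exact (i s t) (j s (t + 1))
  injective_j (s : ℕ) : Function.Injective (j s 0)
  subsingleton_D (t : ℕ) : Subsingleton (D (0, t))

namespace ExactCouple

attribute [instance] ExactCouple.grpD ExactCouple.grpE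

variable (K : ExactCouple.{w})

/-- The map `i`, as an endomorphism of the product of all the groups `D (s, t)`. -/
def I : AddMonoid.End (∀ p, K.D p) where
  toFun y
    | (_, 0) => 0
    | (s, t + 1) => K.i s t (y (s + 1, t))
  map_zero' := by
    funext ⟨s, t⟩
    cases t <;> simp
  map_add' y y' := by
    funext ⟨s, t⟩
    cases t <;> simp

/-- The map `k` out of `E p`, into the product of all the groups `D (s, t)`. -/
def kTot (p : ℕ × ℕ) : K.E p →+ (∀ q, K.D q) :=
  (AddMonoidHom.single K.D (p.1 + 1, p.2)).comp (K.k p.1 p.2)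

/-- The cycles of the page `n + 1`: the `x` such that `k x` is in the image of `i ^ n`. -/
def Z (n : ℕ) (p : ℕ × ℕ) : AddSubgroup (K.E p) :=
  (AddMonoidHom.range (K.I ^ n : AddMonoid.End (∀ p, K.D p))).comap (K.kTot p)

/-- The boundaries of the page `n + 1`: the image under `j` of the kernel of `i ^ n`. -/
def B (n : ℕ) (p : ℕ × ℕ) : AddSubgroup (K.E p) :=
  ((AddMonoidHom.ker (K.I ^ n : AddMonoid.End (∀ p, K.D p))).comap
    (AddMonoidHom.single K.D p)).map (K.j p.1 p.2)

lemma mem_Z {n : ℕ} {p : ℕ × ℕ} {x : K.E p} :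
    x ∈ K.Z n p ↔ ∃ y, (K.I ^ n) y = Pi.single (p.1 + 1, p.2) (K.k p.1 p.2 x) := Iff.rfl

lemma mem_B {n : ℕ} {p : ℕ × ℕ} {x : K.E p} :
    x ∈ K.B n p ↔ ∃ y : K.D p, (K.I ^ n) (Pi.single p y) = 0 ∧ K.j p.1 p.2 y = x := Iff.rfl

lemma I_zero (y : ∀ p, K.D p) (s : ℕ) : K.I y (s, 0) = 0 := rfl

lemma I_succ (y : ∀ p, K.D p) (s t : ℕ) : K.I y (s, t + 1) = K.i s t (y (s + 1, t)) := rfl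

lemma pow_succ_apply (n : ℕ) (y : ∀ p, K.D p) : (K.I ^ (n + 1)) y = (K.I ^ n) (K.I y) := by
  rw [pow_succ]; rfl

lemma pow_succ_apply' (n : ℕ) (y : ∀ p, K.D p) : (K.I ^ (n + 1)) y = K.I ((K.I ^ n) y) := by
  rw [pow_succ']; rfl

lemma I_single (s t : ℕ) (v : K.D (s + 1, t)) :
    K.I (Pi.single (s + 1, t) v) = Pi.single (s, t + 1) (K.i s t v) := by
  funext ⟨s', t'⟩
  cases t' with
  | zero => rw [I_zero, Pi.single_eq_of_ne (by simp)]
  | succ t' =>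
    rw [I_succ]
    by_cases h : s' = s ∧ t' = t
    · obtain ⟨rfl, rfl⟩ := h
      simp
    · rw [Pi.single_eq_of_ne (by simpa using h), Pi.single_eq_of_ne (by simpa using h), map_zero]

lemma I_single_zero (t : ℕ) (v : K.D (0, t)) : K.I (Pi.single (0, t) v) = 0 := by
  have := K.subsingleton_D t
  rw [Subsingleton.elim v 0, Pi.single_zero, map_zero]

/-- An `n`-fold lift of a homogeneous element can be chosen homogeneous. -/
lemma pow_homogeneous (n : ℕ) : ∀ (y : ∀ p, K.D p) (s t t' : ℕ) (v : K.D (s, t)) (_ : t = t' + n)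
    (_ : (K.I ^ n) y = Pi.single (s, t) v),
    (K.I ^ n) (Pi.single (s + n, t') (y (s + n, t'))) = Pi.single (s, t) v := by
  induction n with
  | zero =>
    intro y s t t' v ht hy
    obtain rfl : t = t' := ht
    obtain rfl : y = Pi.single (s, t) v := hy
    simp
  | succ n ih =>
    intro y s t t' v ht hy
    rw [pow_succ_apply] at hy
    have := ih (K.I y) s t (t' + 1) v (by omega) hy
    rw [I_succ, ← I_single, ← pow_succ_apply] at this
    exact this

lemma eq_zero_of_pow (n : ℕ) : ∀ (y : ∀ p, K.D p) (s t : ℕ) (v : K.D (s, t)) (_ : t < n)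
    (_ : (K.I ^ n) y = Pi.single (s, t) v), v = 0 := by
  induction n with
  | zero => intro y s t v ht; omega
  | succ n ih =>
    intro y s t v ht hy
    obtain _ | t := t
    · rw [pow_succ_apply'] at hy
      have := congrFun hy (s, 0)
      rw [I_zero, Pi.single_eq_same] at this
      exact this.symm
    · rw [pow_succ_apply] at hy
      by_cases h : t + 1 < n
      · exact ih _ s (t + 1) v h hy
      · obtain rfl : n = t + 1 := by omega
        have := K.pow_homogeneous (t + 1) (K.I y) s (t + 1) 0 v (by omega) hy
        rw [I_zero, Pi.single_zero, map_zero] at this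
        simpa using this.symm

/-- The iterate `i ^ n` on a homogeneous element is homogeneous. -/
lemma exists_pow_single (n : ℕ) : ∀ (s t : ℕ) (v : K.D (s + n, t)),
    ∃ z : K.D (s, t + n), (K.I ^ n) (Pi.single (s + n, t) v) = Pi.single (s, t + n) z := by
  induction n with
  | zero => intro s t v; exact ⟨v, rfl⟩
  | succ n ih =>
    intro s t v
    obtain ⟨z, hz⟩ := ih s (t + 1) (K.i (s + n) t v)
    have e : (s, t + 1 + n) = (s, t + (n + 1)) := by ext <;> simp; omega
    rw [pow_succ_apply]
    have h2 : K.I (Pi.single (s + (n + 1), t) v) = Pi.single (s + n, t + 1) (K.i (s + n) t v) :=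
      K.I_single (s + n) t v
    rw [h2, hz]
    clear hz h2
    revert z
    rw [e]
    intro z
    exact ⟨z, rfl⟩

lemma pow_single_eq_zero (n : ℕ) : ∀ (s t : ℕ) (_ : s < n) (v : K.D (s, t)),
    (K.I ^ n) (Pi.single (s, t) v) = 0 := by
  induction n with
  | zero => intro s t h; omega
  | succ n ih =>
    intro s t h v
    rw [pow_succ_apply]
    obtain _ | s := s
    · rw [I_single_zero, map_zero]
    · rw [I_single, ih _ _ (by omega)]

lemma kj (s t : ℕ) (y : K.D (s, t)) : K.k s t (K.j s t y) = 0 :=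
  (K.exact_jk s t).apply_apply_eq_zero y

lemma j_mem_Z (n : ℕ) {p : ℕ × ℕ} (y : K.D p) : K.j p.1 p.2 y ∈ K.Z n p :=
  K.mem_Z.2 ⟨0, by rw [kj, map_zero, Pi.single_zero]⟩

lemma B_le_Z (n : ℕ) (p : ℕ × ℕ) : K.B n p ≤ K.Z n p := by
  rintro _ ⟨y, -, rfl⟩
  exact K.j_mem_Z n y

lemma Z_anti (n : ℕ) (p : ℕ × ℕ) : K.Z (n + 1) p ≤ K.Z n p := by
  intro x hx
  obtain ⟨y, hy⟩ := K.mem_Z.1 hx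
  exact K.mem_Z.2 ⟨K.I y, by rw [← pow_succ_apply, hy]⟩

lemma B_mono (n : ℕ) (p : ℕ × ℕ) : K.B n p ≤ K.B (n + 1) p := by
  intro x hx
  obtain ⟨y, hy, rfl⟩ := K.mem_B.1 hx
  exact K.mem_B.2 ⟨y, by rw [pow_succ_apply', hy, map_zero], rfl⟩

/-- The term of bidegree `p` on the page `n + 1`. -/
abbrev Page (n : ℕ) (p : ℕ × ℕ) : Type w := K.Z n p ⧸ (K.B n p).addSubgroupOf (K.Z n p)

/-- The class on the page `n + 1` of a cycle. -/
abbrev cls (n : ℕ) (p : ℕ × ℕ) : K.Z n p →+ K.Page n p := QuotientAddGroup.mk' _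

lemma cls_eq_zero {n : ℕ} {p : ℕ × ℕ} {x : K.Z n p} : K.cls n p x = 0 ↔ (x : K.E p) ∈ K.B n p :=
  QuotientAddGroup.eq_zero_iff x

/-- On the first page every element is a cycle. -/
lemma Z_zero (p : ℕ × ℕ) : K.Z 0 p = ⊤ :=
  eq_top_iff.2 fun _ _ ↦ K.mem_Z.2 ⟨_, rfl⟩

/-- On the first page only `0` is a boundary, so that the term of bidegree `p` is `E p`. -/
lemma B_zero (p : ℕ × ℕ) : K.B 0 p = ⊥ := by
  rw [eq_bot_iff]
  rintro x ⟨y, hy, rfl⟩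
  have hy : Pi.single p y = (0 : ∀ p, K.D p) := hy
  rw [Pi.single_eq_zero_iff] at hy
  rw [hy, map_zero]
  exact zero_mem _

/-- The bidegrees `a`, `b` with `b = a + (n + 1, -n)`. -/
def Rel (n : ℕ) (a b : ℕ × ℕ) : Prop := a.1 + (n + 1) = b.1 ∧ b.2 + n = a.2

variable {K} in
lemma exists_lift {n : ℕ} {a b : ℕ × ℕ} (h : Rel n a b) (x : K.Z n a) :
    ∃ y : K.D b, (K.I ^ n) (Pi.single b y) = K.kTot a x := by
  obtain ⟨y, hy⟩ := K.mem_Z.1 x.2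
  obtain ⟨a1, a2⟩ := a
  obtain ⟨b1, b2⟩ := b
  obtain ⟨h1, h2⟩ := h
  dsimp only at h1 h2
  obtain rfl : b1 = a1 + 1 + n := by omega
  exact ⟨_, K.pow_homogeneous n y _ _ b2 _ h2.symm hy⟩

/-- Well-definedness of the differential: two lifts differ by a boundary. -/
lemma cls_lift_eq {n : ℕ} {b : ℕ × ℕ} {y y' : K.D b}
    (h : (K.I ^ n) (Pi.single b y) = (K.I ^ n) (Pi.single b y')) :
    K.cls n b ⟨_, K.j_mem_Z n y⟩ = K.cls n b ⟨_, K.j_mem_Z n y'⟩ := by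
  rw [← sub_eq_zero, ← map_sub, cls_eq_zero]
  refine K.mem_B.2 ⟨y - y', ?_, by simp⟩
  rw [Pi.single_sub, map_sub, h, sub_self]

/-- The differential of the page `n + 1` on cycles: `x ↦ j y`, where `i ^ n y = k x`. -/
def dZ {n : ℕ} {a b : ℕ × ℕ} (h : Rel n a b) : K.Z n a →+ K.Page n b :=
  AddMonoidHom.mk' (fun x ↦ K.cls n b ⟨_, K.j_mem_Z n (exists_lift h x).choose⟩) (fun x x' ↦ by
    rw [← map_add]
    refine Eq.trans (K.cls_lift_eq (y' := (exists_lift h x).choose + (exists_lift h x').choose) ?_)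
      (congrArg _ (Subtype.ext (by simp)))
    rw [(exists_lift h (x + x')).choose_spec, Pi.single_add, map_add,
      (exists_lift h x).choose_spec, (exists_lift h x').choose_spec]
    simp)

lemma dZ_eq {n : ℕ} {a b : ℕ × ℕ} (h : Rel n a b) (x : K.Z n a) (y : K.D b)
    (hy : (K.I ^ n) (Pi.single b y) = K.kTot a x) :
    K.dZ h x = K.cls n b ⟨_, K.j_mem_Z n y⟩ :=
  K.cls_lift_eq (by rw [hy]; exact (exists_lift h x).choose_spec)

lemma dZ_j {n : ℕ} {a b : ℕ × ℕ} (h : Rel n a b) (y : K.D a) :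
    K.dZ h ⟨_, K.j_mem_Z n y⟩ = 0 := by
  have hk : K.kTot a (K.j a.1 a.2 y) = 0 := by
    change Pi.single (a.1 + 1, a.2) (K.k a.1 a.2 (K.j a.1 a.2 y)) = 0
    rw [kj, Pi.single_zero]
  rw [K.dZ_eq h _ 0 (by rw [hk, Pi.single_zero, map_zero]), cls_eq_zero]
  simp [zero_mem]

/-- The differential of the page `n + 1`, of bidegree `(n + 1, -n)`. -/
def d {n : ℕ} {a b : ℕ × ℕ} (h : Rel n a b) : K.Page n a →+ K.Page n b :=
  QuotientAddGroup.lift _ (K.dZ h) (fun x hx ↦ by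
    obtain ⟨y, -, hy⟩ := K.mem_B.1 (AddSubgroup.mem_addSubgroupOf.1 hx)
    obtain rfl : x = ⟨_, K.j_mem_Z n y⟩ := Subtype.ext hy.symm
    exact K.dZ_j h y)

lemma d_cls {n : ℕ} {a b : ℕ × ℕ} (h : Rel n a b) (x : K.Z n a) :
    K.d h (K.cls n a x) = K.dZ h x := rfl

lemma d_comp_d {n : ℕ} {a b c : ℕ × ℕ} (h : Rel n a b) (h' : Rel n b c) (x : K.Page n a) :
    K.d h' (K.d h x) = 0 := by
  obtain ⟨x, rfl⟩ := QuotientAddGroup.mk'_surjective _ x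
  exact K.dZ_j h' _

lemma d_cls_eq_zero {n : ℕ} {a b : ℕ × ℕ} (h : Rel n a b) (x : K.Z n a) :
    K.d h (K.cls n a x) = 0 ↔ (x : K.E a) ∈ K.Z (n + 1) a := by
  obtain ⟨y, hy⟩ := exists_lift h x
  rw [d_cls, K.dZ_eq h x y hy, cls_eq_zero]
  constructor
  · intro hB
    obtain ⟨w, hw, hw'⟩ := K.mem_B.1 hB
    obtain ⟨b1, b2⟩ := b
    have hj : K.j b1 b2 (y - w) = 0 := by
      rw [map_sub, sub_eq_zero]; exact hw'.symm
    suffices h3 : ∃ v, K.I v = Pi.single (b1, b2) (y - w) by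
      obtain ⟨v, hv⟩ := h3
      refine K.mem_Z.2 ⟨v, ?_⟩
      rw [pow_succ_apply, hv, Pi.single_sub, map_sub, hw, sub_zero, hy]
      rfl
    obtain _ | b2 := b2
    · refine ⟨0, ?_⟩
      rw [K.injective_j b1 (hj.trans (map_zero _).symm)]
      simp
    · obtain ⟨v, hv⟩ := (K.exact_ij b1 b2 _).1 hj
      exact ⟨Pi.single (b1 + 1, b2) v, by rw [I_single, hv]⟩
  · intro hx
    obtain ⟨v, hv⟩ := K.mem_Z.1 hx
    rw [pow_succ_apply] at hv
    obtain ⟨a1, a2⟩ := a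
    obtain ⟨b1, b2⟩ := b
    obtain ⟨h1, h2⟩ := h
    dsimp only at h1 h2
    obtain rfl : b1 = a1 + 1 + n := by omega
    have h4 := K.pow_homogeneous n _ _ _ b2 _ h2.symm hv
    refine K.mem_B.2 ⟨y - (K.I v) (a1 + 1 + n, b2), ?_, ?_⟩
    · rw [Pi.single_sub, map_sub, h4, hy, sub_eq_zero]
      rfl
    · rw [map_sub, sub_eq_self]
      obtain _ | b2 := b2
      · rw [I_zero, map_zero]
      · rw [I_succ]
        exact (K.exact_ij _ _).apply_apply_eq_zero _

lemma Z_succ_eq {n : ℕ} {a : ℕ × ℕ} (h : a.2 < n) (x : K.Z n a) : (x : K.E a) ∈ K.Z (n + 1) a := by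
  obtain ⟨y, hy⟩ := K.mem_Z.1 x.2
  exact K.mem_Z.2 ⟨0, by rw [K.eq_zero_of_pow n y _ _ _ h hy]; simp⟩

lemma mem_range_d {n : ℕ} {a b : ℕ × ℕ} (h : Rel n a b) (x : K.Z n b) :
    K.cls n b x ∈ (K.d h).range ↔ (x : K.E b) ∈ K.B (n + 1) b := by
  constructor
  · rintro ⟨z, hz⟩
    obtain ⟨z, rfl⟩ := QuotientAddGroup.mk'_surjective _ z
    obtain ⟨y, hy⟩ := exists_lift h z
    have hz : K.d h (K.cls n a z) = K.cls n b x := hz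
    rw [d_cls, K.dZ_eq h z y hy, ← sub_eq_zero, ← map_sub, cls_eq_zero] at hz
    have h1 := K.B_mono n b hz
    have h2 : K.j b.1 b.2 y ∈ K.B (n + 1) b := by
      refine K.mem_B.2 ⟨y, ?_, rfl⟩
      rw [pow_succ_apply', hy]
      change K.I (Pi.single (a.1 + 1, a.2) _) = 0
      rw [I_single, (K.exact_ki _ _).apply_apply_eq_zero, Pi.single_zero]
    simpa using sub_mem h2 h1
  · intro hx
    obtain ⟨y, hy, hyx⟩ := K.mem_B.1 hx
    obtain ⟨a1, a2⟩ := a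
    obtain ⟨b1, b2⟩ := b
    obtain ⟨h1, h2⟩ := id h
    dsimp only at h1 h2
    obtain rfl : b1 = a1 + 1 + n := by omega
    obtain rfl : a2 = b2 + n := by omega
    obtain ⟨z, hz⟩ := K.exists_pow_single n (a1 + 1) b2 y
    rw [pow_succ_apply', hz, I_single, Pi.single_eq_zero_iff] at hy
    obtain ⟨e, rfl⟩ := (K.exact_ki _ _ _).1 hy
    let e' : K.Z n (a1, b2 + n) := ⟨e, K.mem_Z.2 ⟨_, hz⟩⟩
    refine ⟨K.cls n _ e', ?_⟩
    rw [d_cls, K.dZ_eq h e' y hz]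
    exact congrArg _ (Subtype.ext hyx)

lemma mem_B_succ_of_le {n : ℕ} {b : ℕ × ℕ} (h : b.1 ≤ n) (x : K.E b) :
    x ∈ K.B n b ↔ x ∈ K.B (n + 1) b := by
  refine ⟨fun hx ↦ K.B_mono n b hx, fun hx ↦ ?_⟩
  obtain ⟨y, hy, rfl⟩ := K.mem_B.1 hx
  refine K.mem_B.2 ⟨y, ?_, rfl⟩
  obtain ⟨b1, b2⟩ := b
  dsimp only at h
  obtain h | rfl := h.lt_or_eq
  · exact K.pow_single_eq_zero _ _ _ h y
  · have key : ∀ (m : ℕ) (_ : m = 0 + b1) (y : K.D (m, b2)),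
        (K.I ^ b1) (Pi.single (m, b2) y) = 0 := by
      rintro _ rfl y
      obtain ⟨z, hz⟩ := K.exists_pow_single b1 0 b2 y
      have := K.subsingleton_D (b2 + b1)
      rw [hz, Subsingleton.elim z 0, Pi.single_zero]
    exact key b1 (by omega) y

/-- The complex shape of the differentials of bidegree `(n + 1, -n)` in the first quadrant is
the relation `Rel n`. -/
lemma rel_iff {r : ℤ} (n : ℕ) (hr : r = n + 1) (a b : ℕ × ℕ) :
    (ComplexShape.spectralSequenceNat ⟨r, 1 - r⟩).Rel a b ↔ Rel n a b := by
  subst hr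
  simp only [ComplexShape.spectralSequenceNat_rel_iff, Rel]
  omega

open scoped Classical in
/-- The page `n + 1`, as a complex of abelian groups. -/
def pageComplex (n : ℕ) (r : ℤ) (hr : r = n + 1) :
    HomologicalComplex AddCommGrpCat.{w} (ComplexShape.spectralSequenceNat ⟨r, 1 - r⟩) where
  X p := AddCommGrpCat.of (K.Page n p)
  d a b := if h : Rel n a b then AddCommGrpCat.ofHom (K.d h) else 0
  shape a b h := dif_neg (fun h' ↦ h ((rel_iff n hr a b).2 h'))
  d_comp_d' a b c h h' := by
    rw [dif_pos ((rel_iff n hr a b).1 h), dif_pos ((rel_iff n hr b c).1 h')]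
    refine AddCommGrpCat.hom_ext (AddMonoidHom.ext fun x ↦ ?_)
    exact K.d_comp_d _ _ x

lemma pageComplex_d {n : ℕ} {r : ℤ} (hr : r = n + 1) {a b : ℕ × ℕ} (h : Rel n a b) :
    (K.pageComplex n r hr).d a b = AddCommGrpCat.ofHom (K.d h) := dif_pos h

lemma pageComplex_d_eq_zero {n : ℕ} {r : ℤ} (hr : r = n + 1) {a b : ℕ × ℕ} (h : ¬ Rel n a b) :
    (K.pageComplex n r hr).d a b = 0 := dif_neg h

lemma pageComplex_ker {n : ℕ} {r : ℤ} (hr : r = n + 1) (p : ℕ × ℕ) (x : K.Z n p) :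
    ((K.pageComplex n r hr).sc p).g.hom (K.cls n p x) = 0 ↔ (x : K.E p) ∈ K.Z (n + 1) p := by
  by_cases h : n ≤ p.2
  · have h' : Rel n p (p.1 + (n + 1), p.2 - n) := ⟨rfl, by simp; omega⟩
    have e := ComplexShape.next_eq' _ ((rel_iff n hr _ _).2 h')
    change ((K.pageComplex n r hr).d p _).hom (K.cls n p x) = 0 ↔ _
    rw [e, K.pageComplex_d hr h']
    exact K.d_cls_eq_zero h' x
  · have h' : ¬ Rel n p ((ComplexShape.spectralSequenceNat ⟨r, 1 - r⟩).next p) := by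
      rintro ⟨-, h2⟩
      omega
    change ((K.pageComplex n r hr).d p _).hom (K.cls n p x) = 0 ↔ _
    rw [K.pageComplex_d_eq_zero hr h']
    exact ⟨fun _ ↦ K.Z_succ_eq (by omega) x, fun _ ↦ rfl⟩

lemma pageComplex_range {n : ℕ} {r : ℤ} (hr : r = n + 1) (p : ℕ × ℕ) (x : K.Z n p) :
    (∃ z, ((K.pageComplex n r hr).sc p).f.hom z = K.cls n p x) ↔
      (x : K.E p) ∈ K.B (n + 1) p := by
  by_cases h : n + 1 ≤ p.1
  · have h' : Rel n (p.1 - (n + 1), p.2 + n) p := ⟨by simp; omega, rfl⟩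
    have e := ComplexShape.prev_eq' _ ((rel_iff n hr _ _).2 h')
    change (∃ z, ((K.pageComplex n r hr).d _ p).hom z = K.cls n p x) ↔ _
    rw [e, K.pageComplex_d hr h']
    exact K.mem_range_d h' x
  · have h' : ¬ Rel n ((ComplexShape.spectralSequenceNat ⟨r, 1 - r⟩).prev p) p := by
      rintro ⟨h1, -⟩
      omega
    change (∃ z, ((K.pageComplex n r hr).d _ p).hom z = K.cls n p x) ↔ _
    rw [K.pageComplex_d_eq_zero hr h', ← K.mem_B_succ_of_le (by omega), ← K.cls_eq_zero]
    exact ⟨fun ⟨_, hz⟩ ↦ hz.symm, fun hz ↦ ⟨0, hz.symm⟩⟩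

/-- The map from the cycles of the page `n + 2` to the homology of the page `n + 1`. -/
def toHomology (n : ℕ) (r : ℤ) (hr : r = n + 1) (p : ℕ × ℕ) :
    K.Z (n + 1) p →+ (AddMonoidHom.ker ((K.pageComplex n r hr).sc p).g.hom ⧸
      AddMonoidHom.range ((K.pageComplex n r hr).sc p).abToCycles) :=
  (QuotientAddGroup.mk' _).comp
    (((K.cls n p).comp (AddSubgroup.inclusion (K.Z_anti n p))).codRestrict _
      (fun x ↦ (K.pageComplex_ker hr p _).2 x.2))

lemma toHomology_surjective (n : ℕ) (r : ℤ) (hr : r = n + 1) (p : ℕ × ℕ) :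
    Function.Surjective (K.toHomology n r hr p) := by
  intro z
  obtain ⟨⟨z, hz⟩, rfl⟩ := QuotientAddGroup.mk'_surjective _ z
  obtain ⟨x, rfl⟩ := QuotientAddGroup.mk'_surjective _ z
  exact ⟨⟨x, (K.pageComplex_ker hr p x).1 hz⟩, rfl⟩

lemma toHomology_ker (n : ℕ) (r : ℤ) (hr : r = n + 1) (p : ℕ × ℕ) :
    (K.toHomology n r hr p).ker = (K.B (n + 1) p).addSubgroupOf (K.Z (n + 1) p) := by
  ext x
  rw [AddSubgroup.mem_addSubgroupOf]
  refine Iff.trans ?_ (K.pageComplex_range hr p (AddSubgroup.inclusion (K.Z_anti n p) x))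
  refine (QuotientAddGroup.eq_zero_iff _).trans ?_
  exact exists_congr (fun z ↦ Subtype.ext_iff)

/-- The homology of the page `n + 1` is the page `n + 2`. -/
def pageIso (n : ℕ) (r : ℤ) (hr : r = n + 1) (p : ℕ × ℕ) :
    (K.pageComplex n r hr).homology p ≅ AddCommGrpCat.of (K.Page (n + 1) p) :=
  ((K.pageComplex n r hr).sc p).abHomologyIso ≪≫
    (AddEquiv.toAddCommGrpIso
      ((QuotientAddGroup.quotientAddEquivOfEq (K.toHomology_ker n r hr p).symm).trans
        (QuotientAddGroup.quotientKerEquivOfSurjective _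
          (K.toHomology_surjective n r hr p)))).symm

/-- The spectral sequence of an exact couple. -/
def spectralSequence : CohomologicalSpectralSequenceNat AddCommGrpCat.{w} 1 where
  page r hr := K.pageComplex (r - 1).toNat r (by omega)
  iso r r' p hrr' hr :=
    K.pageIso (r - 1).toNat r (by omega) p ≪≫
      eqToIso (by
        have : (r' - 1).toNat = (r - 1).toNat + 1 := by omega
        dsimp only [pageComplex]
        rw [this])

end ExactCouple

/-- A resolution `⋯ → U 1 → U 0 → 0`, spliced from short exact sequences
`0 → V (s + 1) → U s → V s → 0` with `V 0 = 0`. -/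
structure SplicedResolution (C : Type u) [Category.{v} C] [Abelian C] where
  U : ℕ → C
  V : ℕ → C
  ι (s : ℕ) : V (s + 1) ⟶ U s
  π (s : ℕ) : U s ⟶ V s
  zero (s : ℕ) : ι s ≫ π s = 0
  shortExact (s : ℕ) : (ShortComplex.mk (ι s) (π s) (zero s)).ShortExact
  isZero : IsZero (V 0)

namespace SplicedResolution

variable {C : Type u} [Category.{v} C] [Abelian C] [HasExt.{w} C]

lemma subsingleton_ext {Z : C} (hZ : IsZero Z) (X : C) (t : ℕ) : Subsingleton (Ext.{w} Z X t) := by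
  refine ⟨fun x y ↦ ?_⟩
  rw [← Ext.mk₀_id_comp x, ← Ext.mk₀_id_comp y, hZ.eq_of_src (𝟙 Z) 0]
  simp

/-- The exact couple made of the long exact sequences of `Ext^t(-, X)` attached to the short
exact sequences of a spliced resolution. -/
def exactCouple (R : SplicedResolution C) (X : C) : ExactCouple.{w} where
  D p := Ext.{w} (R.V p.1) X p.2
  E p := Ext.{w} (R.U p.1) X p.2
  i s t := (R.shortExact s).extClass.precomp X (add_comm 1 t)
  j s t := (Ext.mk₀ (R.π s)).precomp X (zero_add t)
  k s t := (Ext.mk₀ (R.ι s)).precomp X (zero_add t)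
  exact_jk s t := (ShortComplex.ab_exact_iff_function_exact _).1
    (Ext.contravariant_sequence_exact₂' (R.shortExact s) X t)
  exact_ki s t := (ShortComplex.ab_exact_iff_function_exact _).1
    (Ext.contravariant_sequence_exact₁' (R.shortExact s) X t (t + 1) (add_comm 1 t))
  exact_ij s t := (ShortComplex.ab_exact_iff_function_exact _).1
    (Ext.contravariant_sequence_exact₃' (R.shortExact s) X t (t + 1) (add_comm 1 t))
  injective_j s := by
    have : Epi (R.π s) := (R.shortExact s).epi_g
    exact Ext.precomp_mk₀_injective_of_epi X (R.π s)
  subsingleton_D t := subsingleton_ext R.isZero X t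

/-- The resolution spectral sequence
`E_1^{s,t} = Ext^t(U s, X)`, `d_r : E_r^{s,t} → E_r^{s+r,t-r+1}`. -/
def spectralSequence (R : SplicedResolution C) (X : C) :
    CohomologicalSpectralSequenceNat AddCommGrpCat.{w} 1 :=
  (R.exactCouple X).spectralSequence

end SplicedResolution

/-- An additive functor `F : D ⥤ C` is resolving if every object of `D` is a quotient of a
projective object which `F` sends to a projective object. -/
def IsResolving {C : Type u} [Category.{v} C] {D : Type u₂} [Category.{v₂} D] (F : D ⥤ C) : Prop :=
  ∀ X : D, ∃ (P : D) (p : P ⟶ X), Projective P ∧ Projective (F.obj P) ∧ Epi p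

section RelativeNotions

variable {C : Type u} [Category.{v} C] [Abelian C]

/-- `J` is injective relative to the class `W` of short exact sequences. -/
def IsRelInjective (W : ShortComplex C → Prop) (J : C) : Prop :=
  ∀ S : ShortComplex C, W S → ∀ f : S.X₁ ⟶ J, ∃ g : S.X₂ ⟶ J, S.f ≫ g = f

/-- Every object `X` admits a short exact sequence `0 → X → J → Q → 0` in the class `W` with `J`
injective relative to `W`. -/
def EnoughRelInjectives (W : ShortComplex C → Prop) : Prop :=
  ∀ X : C, ∃ S : ShortComplex C, W S ∧ Nonempty (S.X₁ ≅ X) ∧ IsRelInjective W S.X₂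

/-- A contravariant functor `T` is left exact relative to the class `W` if it sends every
`0 → A → B → Q → 0` in `W` to an exact sequence `0 → T Q → T B → T A`. -/
def IsLeftRelExact (W : ShortComplex C → Prop) (T : Cᵒᵖ ⥤ AddCommGrpCat.{w}) : Prop :=
  ∀ S : ShortComplex C, W S →
    Function.Injective (T.map S.g.op) ∧ Function.Exact (T.map S.g.op) (T.map S.f.op)

end RelativeNotions

namespace CompatibleSplitting

open scoped ZeroObject

attribute [local instance] Abelian.hasFiniteBiproducts

variable {C : Type u} [Category.{v} C] [Abelian C] {I : Type u₁} [Finite I]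
  {D : I → Type u₂} [∀ i, Category.{v₂} (D i)]
  {F : ∀ i, D i ⥤ C} {G : ∀ i, C ⥤ D i}

/-- The functor `∏ D i ⥤ C` sending `(X i)` to `⨁ F i (X i)`. -/
@[simps]
def sumFunctor (F : ∀ i, D i ⥤ C) : (∀ i, D i) ⥤ C where
  obj X := ⨁ fun i ↦ (F i).obj (X i)
  map f := biproduct.map fun i ↦ (F i).map (f i)

/-- The bijection `Hom(⨁ F i (X i), Y) ≃ ∏ Hom(X i, G i Y)`. -/
def sumHomEquiv (adj : ∀ i, F i ⊣ G i) (X : ∀ i, D i) (Y : C) :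
    ((⨁ fun i ↦ (F i).obj (X i)) ⟶ Y) ≃ (∀ i, X i ⟶ (G i).obj Y) where
  toFun f i := (adj i).homEquiv _ _ (biproduct.ι (fun i ↦ (F i).obj (X i)) i ≫ f)
  invFun g := biproduct.desc fun i ↦ ((adj i).homEquiv _ _).symm (g i)
  left_inv f := by
    apply biproduct.hom_ext'
    intro i
    simp
  right_inv g := by
    funext i
    simp

lemma ι_sumHomEquiv_symm (adj : ∀ i, F i ⊣ G i) (X : ∀ i, D i) (Y : C)
    (g : ∀ i, X i ⟶ (G i).obj Y) (i : I) :
    biproduct.ι (fun i ↦ (F i).obj (X i)) i ≫ (sumHomEquiv adj X Y).symm g =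
      ((adj i).homEquiv _ _).symm (g i) :=
  biproduct.ι_desc _ _

lemma sumHomEquiv_naturality_left_symm (adj : ∀ i, F i ⊣ G i) {X' X : ∀ i, D i} {Y : C}
    (f : ∀ i, X' i ⟶ X i) (g : ∀ i, X i ⟶ (G i).obj Y) :
    (sumHomEquiv adj X' Y).symm (fun i ↦ f i ≫ g i) =
      biproduct.map (fun i ↦ (F i).map (f i)) ≫ (sumHomEquiv adj X Y).symm g := by
  apply biproduct.hom_ext'
  intro i
  rw [ι_sumHomEquiv_symm, biproduct.ι_map_assoc, ι_sumHomEquiv_symm,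
    Adjunction.homEquiv_naturality_left_symm]

lemma sumHomEquiv_naturality_right (adj : ∀ i, F i ⊣ G i) {X : ∀ i, D i} {Y Y' : C}
    (f : (⨁ fun i ↦ (F i).obj (X i)) ⟶ Y) (g : Y ⟶ Y') (i : I) :
    sumHomEquiv adj X Y' (f ≫ g) i = sumHomEquiv adj X Y f i ≫ (G i).map g := by
  simp only [sumHomEquiv, Equiv.coe_fn_mk, Adjunction.homEquiv_naturality_right,
    Functor.map_comp, Category.assoc]

/-- The functor `sumFunctor F` is left adjoint to the functor `C ⥤ ∏ D i` with components `G i`. -/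
def adjunction (adj : ∀ i, F i ⊣ G i) : sumFunctor F ⊣ Functor.pi' G :=
  Adjunction.mkOfHomEquiv
    { homEquiv := sumHomEquiv adj
      homEquiv_naturality_left_symm f g := sumHomEquiv_naturality_left_symm adj f g
      homEquiv_naturality_right f g := funext (sumHomEquiv_naturality_right adj f g) }

/-- The endofunctor `FG` of `C`, sending `Y` to `⨁ F i (G i Y)`. -/
abbrev FG (F : ∀ i, D i ⥤ C) (G : ∀ i, C ⥤ D i) : C ⥤ C := Functor.pi' G ⋙ sumFunctor F

/-- The counit `ε_Y : FG Y ⟶ Y`. -/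
def ε (adj : ∀ i, F i ⊣ G i) (Y : C) : (FG F G).obj Y ⟶ Y := (adjunction adj).counit.app Y

lemma ι_ε (adj : ∀ i, F i ⊣ G i) (Y : C) (i : I) :
    biproduct.ι (fun i ↦ (F i).obj ((G i).obj Y)) i ≫ ε adj Y = (adj i).counit.app Y := by
  refine (ι_sumHomEquiv_symm adj _ Y (fun i ↦ 𝟙 ((G i).obj Y)) i).trans ?_
  exact (adj i).homEquiv_symm_id Y

instance [Nonempty I] [∀ i, (G i).Faithful] (adj : ∀ i, F i ⊣ G i) (Y : C) : Epi (ε adj Y) := by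
  obtain ⟨i⟩ := ‹Nonempty I›
  have : Epi (biproduct.ι (fun i ↦ (F i).obj ((G i).obj Y)) i ≫ ε adj Y) := by
    rw [ι_ε]
    infer_instance
  exact epi_of_epi (biproduct.ι (fun i ↦ (F i).obj ((G i).obj Y)) i) _

/-- The sequence `0 → ker ε_Y → FG Y → Y → 0`. -/
@[simps]
def counitSequence (adj : ∀ i, F i ⊣ G i) (Y : C) : ShortComplex C :=
  ShortComplex.mk (kernel.ι (ε adj Y)) (ε adj Y) (kernel.condition _)

lemma counitSequence_shortExact [Nonempty I] [∀ i, (G i).Faithful] (adj : ∀ i, F i ⊣ G i) (Y : C) :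
    (counitSequence adj Y).ShortExact where
  exact := ShortComplex.exact_kernel _
  mono_f := inferInstanceAs (Mono (kernel.ι (ε adj Y)))
  epi_g := inferInstanceAs (Epi (ε adj Y))

/-- The class `E` of the sequences `0 → ker ε_Y → FG Y → Y → 0`, up to isomorphism. -/
def counitClass (adj : ∀ i, F i ⊣ G i) (S : ShortComplex C) : Prop :=
  ∃ Y : C, Nonempty (S ≅ counitSequence adj Y)

/-- The class of the short exact sequences of `C` which are split by each of the functors `G i`. -/
def splitClass (G : ∀ i, C ⥤ D i) (S : ShortComplex C) : Prop :=
  S.ShortExact ∧ ∀ i, IsSplitEpi ((G i).map S.g)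

/-- The iterated kernels `Y`, `ker ε_Y`, `ker ε_{ker ε_Y}`, etc. -/
def syzygy (adj : ∀ i, F i ⊣ G i) (Y : C) : ℕ → C
  | 0 => Y
  | n + 1 => kernel (ε adj (syzygy adj Y n))

/-- The exact sequence `⋯ → FG (ker ε_Y) → FG Y → Y → 0`: one has `U 0 = V 1 = Y`,
`U s = FG (V s)` for `s ≥ 1`, and `V (s + 1)` is the kernel of `ε : U s ⟶ V s` for `s ≥ 1`. -/
def resolution [Nonempty I] [∀ i, (G i).Faithful] (adj : ∀ i, F i ⊣ G i) (Y : C) :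
    SplicedResolution C where
  U
    | 0 => Y
    | s + 1 => (FG F G).obj (syzygy adj Y s)
  V
    | 0 => 0
    | s + 1 => syzygy adj Y s
  ι
    | 0 => 𝟙 Y
    | s + 1 => kernel.ι (ε adj (syzygy adj Y s))
  π
    | 0 => 0
    | s + 1 => ε adj (syzygy adj Y s)
  zero
    | 0 => comp_zero
    | _ + 1 => kernel.condition _
  shortExact
    | 0 =>
      { exact := (ShortComplex.exact_iff_epi _ rfl).2 (inferInstanceAs (Epi (𝟙 Y)))
        mono_f := inferInstanceAs (Mono (𝟙 Y))
        epi_g := ⟨fun _ _ _ ↦ (isZero_zero C).eq_of_src _ _⟩ }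
    | s + 1 => counitSequence_shortExact adj (syzygy adj Y s)
  isZero := isZero_zero C

/-- The compatible splitting spectral sequence. -/
def spectralSequence [HasExt.{w} C] [Nonempty I] [∀ i, (G i).Faithful] (adj : ∀ i, F i ⊣ G i)
    (Y X : C) : CohomologicalSpectralSequenceNat AddCommGrpCat.{w} 1 :=
  (resolution adj Y).spectralSequence X

/-- The term `E_2^{s,t}` of the compatible splitting spectral sequence. -/
def E₂ [HasExt.{w} C] [Nonempty I] [∀ i, (G i).Faithful] (adj : ∀ i, F i ⊣ G i)
    (Y X : C) (s t : ℕ) : AddCommGrpCat.{w} :=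
  ((spectralSequence adj Y X).page 2).X (s, t)

end CompatibleSplitting

end

/-! Everything reduces to the canonical sequences `0 → ker ε_Y → FG Y → Y → 0`. Write `T = Ext^t(-,
X)`. On the first page, `d_1` out of column 0 is `T(ε_Y)`, and out of column 1 it is `T(ker ε_Y → FG
Y)` followed by `T(ε_{ker ε_Y})`. So `E_2^{0,t} = 0` for all `Y` says that every `T(ε_Y)` is
injective. Applied to `ker ε_Y`, this injectivity replaces `T(FG (ker ε_Y))` by `T(ker ε_Y)`, and
`E_2^{1,t} = 0` becomes exactness of the canonical sequence at `T(FG Y)`. This is `isZero_E₂_iff`.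

The passage from canonical sequences to all sequences split by the `G i` is
`isLeftRelExact_splitClass`, valid for any additive contravariant functor. By adjunction, sections
of the `G i` of an epimorphism `B → Q` assemble into a map `FG Q → B` over `Q`; this map compares
the given sequence with the canonical one. Conversely, canonical sequences are split by the `G i`,
by a triangle identity. The three conditions of the theorem thus imply one another cyclically. -/

namespace ExactCouple

/-! ### The second page of an exact couple -/

variable (K : ExactCouple.{w})

/-- Exactness gives `im i = ker j`, so cycles are the kernel of `d_1 = j ∘ k`. In row `0` no map `i`
arrives, but `j` is injective there, so both conditions say `k x = 0`. -/
lemma mem_Z_one {s t : ℕ} {x : K.E (s, t)} :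
    x ∈ K.Z 1 (s, t) ↔ K.j (s + 1) t (K.k s t x) = 0 := by
  rw [mem_Z, pow_one]
  constructor
  · rintro ⟨y, hy⟩
    have hy' : K.I y (s + 1, t) = K.k s t x := by rw [hy]; exact Pi.single_eq_same _ _
    rw [← hy']
    cases t with
    | zero => rw [I_zero, map_zero]
    | succ t => exact (K.exact_ij (s + 1) t).apply_apply_eq_zero _
  · intro hx
    cases t with
    | zero =>
      refine ⟨0, ?_⟩
      rw [K.injective_j (s + 1) (hx.trans (map_zero _).symm), Pi.single_zero, map_zero]
    | succ t =>
      obtain ⟨v, hv⟩ := (K.exact_ij (s + 1) t _).1 hx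
      exact ⟨Pi.single (s + 1 + 1, t) v, by rw [I_single, hv]⟩

lemma mem_B_one_zero {t : ℕ} {x : K.E (0, t)} : x ∈ K.B 1 (0, t) ↔ x = 0 := by
  refine ⟨fun hx ↦ ?_, fun hx ↦ hx ▸ zero_mem _⟩
  obtain ⟨y, -, rfl⟩ := K.mem_B.1 hx
  have := K.subsingleton_D t
  exact (congrArg _ (Subsingleton.elim (α := K.D (0, t)) y 0)).trans (map_zero _)

/-- Since `ker i = im k`, the image under `j` of `ker i` is the image of `d_1`. -/
lemma mem_B_one_succ {s t : ℕ} {x : K.E (s + 1, t)} :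
    x ∈ K.B 1 (s + 1, t) ↔ ∃ e : K.E (s, t), K.j (s + 1) t (K.k s t e) = x := by
  rw [mem_B, pow_one]
  constructor
  · rintro ⟨y, hy, rfl⟩
    rw [I_single, Pi.single_eq_zero_iff] at hy
    obtain ⟨e, rfl⟩ := (K.exact_ki _ _ _).1 hy
    exact ⟨e, rfl⟩
  · rintro ⟨e, rfl⟩
    refine ⟨K.k s t e, ?_, rfl⟩
    rw [I_single, (K.exact_ki _ _).apply_apply_eq_zero, Pi.single_zero]

lemma isZero_page_two_iff (p : ℕ × ℕ) :
    IsZero ((K.spectralSequence.page 2).X p) ↔ K.Z 1 p ≤ K.B 1 p := by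
  -- `Page` is indexed one below the page number, and `(2 - 1).toNat` reduces to `1` by computation.
  have h : IsZero ((K.spectralSequence.page 2).X p) ↔ Subsingleton (K.Page 1 p) :=
    AddCommGrpCat.isZero_iff_subsingleton (G := AddCommGrpCat.of (K.Page 1 p))
  rw [h, QuotientAddGroup.subsingleton_iff, AddSubgroup.addSubgroupOf_eq_top]

/-- The term `E_2^{0,t}` vanishes if and only if the differential `d_1` is injective on
`E_1^{0,t}`. -/
lemma isZero_page_two_zero_iff (t : ℕ) :
    IsZero ((K.spectralSequence.page 2).X (0, t)) ↔
      ∀ x : K.E (0, t), K.j 1 t (K.k 0 t x) = 0 → x = 0 := by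
  rw [isZero_page_two_iff]
  exact ⟨fun h x hx ↦ K.mem_B_one_zero.1 (h (K.mem_Z_one.2 hx)),
    fun h x hx ↦ K.mem_B_one_zero.2 (h x (K.mem_Z_one.1 hx))⟩

/-- The term `E_2^{s+1,t}` vanishes if and only if the first page is exact at `E_1^{s+1,t}`. -/
lemma isZero_page_two_succ_iff (s t : ℕ) :
    IsZero ((K.spectralSequence.page 2).X (s + 1, t)) ↔
      ∀ x : K.E (s + 1, t), K.j (s + 2) t (K.k (s + 1) t x) = 0 →
        ∃ e : K.E (s, t), K.j (s + 1) t (K.k s t e) = x := by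
  rw [isZero_page_two_iff]
  exact ⟨fun h x hx ↦ K.mem_B_one_succ.1 (h (K.mem_Z_one.2 hx)),
    fun h x hx ↦ K.mem_B_one_succ.2 (h x (K.mem_Z_one.1 hx))⟩

end ExactCouple

/-! ### Sequences split by the `G i` and the canonical sequences -/

namespace CompatibleSplitting

attribute [local instance] Abelian.hasFiniteBiproducts

section Sequences

variable {C : Type u} [Category.{v} C] [Abelian C] {I : Type u₁} [Finite I]
  {D : I → Type u₂} [∀ i, Category.{v₂} (D i)]
  {F : ∀ i, D i ⥤ C} {G : ∀ i, C ⥤ D i}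

lemma ε_naturality (adj : ∀ i, F i ⊣ G i) {Y Z : C} (g : Y ⟶ Z) :
    (FG F G).map g ≫ ε adj Z = ε adj Y ≫ g :=
  (adjunction adj).counit.naturality g

/-- The counit of the `i`-th adjunction factors through `ε` via the `i`-th summand, and after
applying `G i` it is split by the unit. -/
lemma isSplitEpi_map_ε (adj : ∀ i, F i ⊣ G i) (Y : C) (i : I) :
    IsSplitEpi ((G i).map (ε adj Y)) := by
  obtain ⟨a, ha⟩ : ∃ a : (F i).obj ((G i).obj Y) ⟶ (FG F G).obj Y,
      a ≫ ε adj Y = (adj i).counit.app Y := ⟨_, ι_ε adj Y i⟩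
  exact ⟨⟨{
    section_ := (adj i).unit.app ((G i).obj Y) ≫ (G i).map a
    id := by
      rw [Category.assoc, ← Functor.map_comp, ha]
      exact (adj i).right_triangle_components Y }⟩⟩

/-- A sequence split by each `G i` lifts the counit of its third object. -/
lemma exists_lift_ε (adj : ∀ i, F i ⊣ G i) {S : ShortComplex C} (hS : splitClass G S) :
    ∃ l : (FG F G).obj S.X₃ ⟶ S.X₂, l ≫ S.g = ε adj S.X₃ := by
  have := hS.2
  -- The lift is the adjoint transpose of the chosen sections: composing it with `S.g` gives the
  -- transpose of the identity, which is the counit.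
  have h (i : I) : biproduct.ι (fun i ↦ (F i).obj ((G i).obj S.X₃)) i ≫
      (sumHomEquiv adj (fun i ↦ (G i).obj S.X₃) S.X₂).symm (fun i ↦ section_ ((G i).map S.g)) ≫
        S.g = (adj i).counit.app S.X₃ := by
    rw [← Category.assoc, ι_sumHomEquiv_symm, ← Adjunction.homEquiv_naturality_right_symm,
      IsSplitEpi.id, Adjunction.homEquiv_symm_id]
  exact ⟨_, biproduct.hom_ext' _ _ fun i ↦ (h i).trans (ι_ε adj S.X₃ i).symm⟩

lemma splitClass_of_counitClass [Nonempty I] [∀ i, (G i).Faithful] (adj : ∀ i, F i ⊣ G i)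
    {S : ShortComplex C} (hS : counitClass adj S) : splitClass G S := by
  obtain ⟨Y, ⟨e⟩⟩ := hS
  refine ⟨ShortComplex.shortExact_of_iso e.symm (counitSequence_shortExact adj Y), fun i ↦ ?_⟩
  have hg : S.g = e.hom.τ₂ ≫ (counitSequence adj Y).g ≫ e.inv.τ₃ := by
    rw [e.hom.comm₂₃_assoc, ← ShortComplex.comp_τ₃, e.hom_inv_id, ShortComplex.id_τ₃,
      Category.comp_id]
  have : IsSplitEpi ((G i).map (counitSequence adj Y).g) := isSplitEpi_map_ε adj Y i
  rw [hg, Functor.map_comp, Functor.map_comp]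
  infer_instance

/-- For an additive contravariant functor, left exactness on the sequences
`0 → ker ε_Y → FG Y → Y → 0` implies left exactness on all the sequences split by the `G i`. -/
lemma isLeftRelExact_splitClass (adj : ∀ i, F i ⊣ G i) (T : Cᵒᵖ ⥤ AddCommGrpCat.{w})
    [T.Additive] (hT : ∀ Y : C, Function.Injective (T.map (ε adj Y).op) ∧
      Function.Exact (T.map (ε adj Y).op) (T.map (kernel.ι (ε adj Y)).op)) :
    IsLeftRelExact (splitClass G) T := by
  intro S hS
  have map_comp {A B Z : C} (f : A ⟶ B) (g : B ⟶ Z) (x : T.obj (.op Z)) :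
      T.map (f ≫ g).op x = T.map f.op (T.map g.op x) := by
    rw [op_comp, T.map_comp]; rfl
  have map_zero' {A B : C} (x : T.obj (.op B)) : T.map (0 : A ⟶ B).op x = 0 := by
    rw [op_zero, T.map_zero]; rfl
  obtain ⟨l, hl⟩ := exists_lift_ε adj hS
  have := hS.1.mono_f
  refine ⟨fun x y hxy ↦ (hT S.X₃).1 ?_, fun x ↦ ⟨fun hx ↦ ?_, ?_⟩⟩
  · rw [← hl, map_comp, map_comp, hxy]
  · -- The restriction of `l` to the kernel of the counit factors through `S.f`.
    have hker : T.map (kernel.ι (ε adj S.X₃)).op (T.map l.op x) = 0 := by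
      rw [← map_comp, ← hS.1.exact.lift_f (kernel.ι (ε adj S.X₃) ≫ l)
        (by rw [Category.assoc, hl, kernel.condition]), map_comp, hx, map_zero]
    -- This `z` is the only candidate for a preimage of `x`. That `T(S.g) z = x` is tested after the
    -- injective map `T(ε)` at the middle object, where naturality of `ε` turns it into a comparison
    -- of two maps `FG S.X₂ → S.X₂`.
    obtain ⟨z, hz⟩ := ((hT S.X₃).2 _).1 hker
    refine ⟨z, (hT S.X₂).1 ?_⟩
    rw [← map_comp, ← ε_naturality, map_comp, hz, ← map_comp, ← sub_eq_zero]
    -- Both maps lie over `S.X₃`, so their difference factors through `S.f`, and `T(S.f)` kills `x`.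
    -- Additivity of `T` is what lets the difference be taken inside `T`.
    have hsub : ((FG F G).map S.g ≫ l - ε adj S.X₂) ≫ S.g = 0 := by
      rw [Preadditive.sub_comp, Category.assoc, hl, ε_naturality, sub_self]
    have hdiff : T.map ((FG F G).map S.g ≫ l).op x - T.map (ε adj S.X₂).op x =
        T.map ((FG F G).map S.g ≫ l - ε adj S.X₂).op x := by
      rw [op_sub, T.map_sub]; rfl
    rw [hdiff, ← hS.1.exact.lift_f _ hsub, map_comp, hx, map_zero]
  · rintro ⟨z, rfl⟩
    rw [← map_comp, S.zero, map_zero']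

end Sequences

/-! ### Vanishing on the second page in terms of `Ext` -/

section Ext

variable {C : Type u} [Category.{v} C] [Abelian C] [HasExt.{w} C] {I : Type u₁} [Finite I]
  [Nonempty I] {D : I → Type u₂} [∀ i, Category.{v₂} (D i)]
  {F : ∀ i, D i ⥤ C} {G : ∀ i, C ⥤ D i} [∀ i, (G i).Faithful]

instance additive_extFunctor_flip_obj (X : C) (t : ℕ) :
    ((extFunctor.{w} t).flip.obj X).Additive where
  map_add {A B} {f g} := by
    refine AddCommGrpCat.hom_ext (AddMonoidHom.ext fun x ↦ ?_)
    change (Ext.mk₀ (f.unop + g.unop)).comp x (zero_add t) =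
      (Ext.mk₀ f.unop).comp x (zero_add t) + (Ext.mk₀ g.unop).comp x (zero_add t)
    exact (congrArg (fun a ↦ Ext.comp a x (zero_add t)) (Ext.mk₀_add _ _)).trans
      (Ext.add_comp _ _ _ _)

/-- The resolution starts with `U 0 = V 1 = Y` joined by the identity, so `k` is trivial in column 0
and `d_1` is restriction along the counit. -/
lemma isZero_E₂_zero_iff (adj : ∀ i, F i ⊣ G i) (Y X : C) (t : ℕ) :
    IsZero (E₂.{w} adj Y X 0 t) ↔ ∀ x : Ext.{w} Y X t,
      (Ext.mk₀ (ε adj Y)).comp x (zero_add t) = 0 → x = 0 := by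
  have h : IsZero (E₂.{w} adj Y X 0 t) ↔ ∀ x : Ext.{w} Y X t,
      (Ext.mk₀ (ε adj Y)).comp ((Ext.mk₀ (𝟙 Y)).comp x (zero_add t)) (zero_add t) = 0 → x = 0 :=
    ExactCouple.isZero_page_two_zero_iff _ t
  simpa only [Ext.mk₀_id_comp] using h

lemma isZero_E₂_one_iff (adj : ∀ i, F i ⊣ G i) (Y X : C) (t : ℕ) :
    IsZero (E₂.{w} adj Y X 1 t) ↔ ∀ x : Ext.{w} ((FG F G).obj Y) X t,
      (Ext.mk₀ (ε adj (kernel (ε adj Y)))).comp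
          ((Ext.mk₀ (kernel.ι (ε adj Y))).comp x (zero_add t)) (zero_add t) = 0 →
        ∃ e : Ext.{w} Y X t, (Ext.mk₀ (ε adj Y)).comp e (zero_add t) = x := by
  have h : IsZero (E₂.{w} adj Y X 1 t) ↔ ∀ x : Ext.{w} ((FG F G).obj Y) X t,
      (Ext.mk₀ (ε adj (kernel (ε adj Y)))).comp
          ((Ext.mk₀ (kernel.ι (ε adj Y))).comp x (zero_add t)) (zero_add t) = 0 →
        ∃ e : Ext.{w} Y X t, (Ext.mk₀ (ε adj Y)).comp
          ((Ext.mk₀ (𝟙 Y)).comp e (zero_add t)) (zero_add t) = x :=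
    ExactCouple.isZero_page_two_succ_iff _ 0 t
  simpa only [Ext.mk₀_id_comp] using h

/-- The vanishing of `E_2^{0,t}` and `E_2^{1,t}` for all `Y` amounts to the left exactness of
`Ext^t(-, X)` on the sequences `0 → ker ε_Y → FG Y → Y → 0`. -/
lemma isZero_E₂_iff (adj : ∀ i, F i ⊣ G i) (X : C) (t : ℕ) :
    (∀ Y : C, IsZero (E₂.{w} adj Y X 0 t) ∧ IsZero (E₂.{w} adj Y X 1 t)) ↔
      ∀ Y : C, Function.Injective (((extFunctor.{w} t).flip.obj X).map (ε adj Y).op) ∧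
        Function.Exact (((extFunctor.{w} t).flip.obj X).map (ε adj Y).op)
          (((extFunctor.{w} t).flip.obj X).map (kernel.ι (ε adj Y)).op) := by
  simp only [isZero_E₂_zero_iff, isZero_E₂_one_iff]
  constructor
  · refine fun h Y ↦ ⟨(injective_iff_map_eq_zero _).2 (h Y).1, fun x ↦ ⟨fun hx ↦ ?_, ?_⟩⟩
    · refine (h Y).2 x ?_
      -- A class that vanishes on `ker ε_Y` also vanishes on `FG (ker ε_Y)`, so it is a `d_1`-cycle.
      exact (congrArg (fun a ↦ (Ext.mk₀ (ε adj (kernel (ε adj Y)))).comp a (zero_add t)) hx).trans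
        (Ext.comp_zero _ _ _ _ _)
    · rintro ⟨e, rfl⟩
      change (Ext.mk₀ (kernel.ι (ε adj Y))).comp
        ((Ext.mk₀ (ε adj Y)).comp (show Ext.{w} Y X t from e) (zero_add t)) (zero_add t) = 0
      rw [Ext.mk₀_comp_mk₀_assoc, kernel.condition, Ext.mk₀_zero, Ext.zero_comp]
  · refine fun h Y ↦ ⟨(injective_iff_map_eq_zero _).1 (h Y).1, fun x hx ↦ ?_⟩
    -- Injectivity is used at the object `ker ε_Y` rather than at `Y`: it descends the vanishing on
    -- `FG (ker ε_Y)` to `ker ε_Y`. This is where quantifying over all objects matters.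
    exact ((h Y).2 x).1 ((injective_iff_map_eq_zero _).1 (h (kernel (ε adj Y))).1 _ hx)

end Ext

end CompatibleSplitting

theorem mainTheorem10 {C : Type u} [Category.{v} C] [Abelian C] [HasExt.{w} C]
    {I : Type u₁} [Finite I] [Nonempty I]
    {D : I → Type u₂} [∀ i, Category.{v₂} (D i)] [∀ i, Abelian (D i)]
    {F : ∀ i, D i ⥤ C} {G : ∀ i, C ⥤ D i} (adj : ∀ i, F i ⊣ G i)
    [∀ i, (G i).Faithful]
    [∀ i, PreservesFiniteLimits (G i)] [∀ i, PreservesFiniteColimits (G i)]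
    [∀ i, PreservesFiniteLimits (F i)] [∀ i, PreservesFiniteColimits (F i)]
    (hF : ∀ i, IsResolving (F i))
    (hinj : EnoughRelInjectives (CompatibleSplitting.splitClass G))
    (X : C) (t : ℕ) :
    (IsLeftRelExact (CompatibleSplitting.splitClass G) ((extFunctor.{w} t).flip.obj X) ↔
      ∀ Y : C, IsZero (CompatibleSplitting.E₂.{w} adj Y X 0 t) ∧
        IsZero (CompatibleSplitting.E₂.{w} adj Y X 1 t)) ∧
    (IsLeftRelExact (CompatibleSplitting.counitClass adj) ((extFunctor.{w} t).flip.obj X) ↔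
      ∀ Y : C, IsZero (CompatibleSplitting.E₂.{w} adj Y X 0 t) ∧
        IsZero (CompatibleSplitting.E₂.{w} adj Y X 1 t)) := by
  have split_counit (h : IsLeftRelExact (CompatibleSplitting.splitClass G)
      ((extFunctor.{w} t).flip.obj X)) :
      IsLeftRelExact (CompatibleSplitting.counitClass adj) ((extFunctor.{w} t).flip.obj X) :=
    fun S hS ↦ h S (CompatibleSplitting.splitClass_of_counitClass adj hS)
  have counit_zero (h : IsLeftRelExact (CompatibleSplitting.counitClass adj)
      ((extFunctor.{w} t).flip.obj X)) :=
    (CompatibleSplitting.isZero_E₂_iff.{w} adj X t).2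
      fun Y ↦ h (CompatibleSplitting.counitSequence adj Y) ⟨Y, ⟨Iso.refl _⟩⟩
  have zero_split (h : ∀ Y : C, IsZero (CompatibleSplitting.E₂.{w} adj Y X 0 t) ∧
      IsZero (CompatibleSplitting.E₂.{w} adj Y X 1 t)) :=
    CompatibleSplitting.isLeftRelExact_splitClass adj ((extFunctor.{w} t).flip.obj X)
      ((CompatibleSplitting.isZero_E₂_iff.{w} adj X t).1 h)
  exact ⟨⟨fun h ↦ counit_zero (split_counit h), zero_split⟩,
    ⟨counit_zero, fun h ↦ split_counit (zero_split h)⟩⟩
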